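/- All rings are associative with $1$ and are algebras over a commutative ring $K$ (for instance $K=\mathbb{Z}$). Let $R$ be a ring and let $\mathcal{C}_R$ be its set of regular elements (neither left nor right zero divisors). A multiplicative set of $R$ is a submonoid $S$ of $(R,\cdot)$ with $0\notin S$. For such an $S$ let $R\langle S^{-1}\rangle$ be the quotient of the $K$-algebra freely generated by $R$ and noncommuting indeterminates $x_s$ $(s\in S)$ by the ideal generated by all $sx_s-1$ and $x_ss-1$. The set $S$ is called left localizable if $R\langle S^{-1}\rangle\neq 0$ and every element of $R\langle S^{-1}\rangle$ has the form $\bar s^{-1}\bar r$, where $\bar s,\bar r$ are the images of some $s\in S$, $r\in R$. It is called a left denominator set if $Sr\cap Rs\neq\emptyset$ for all $r\in R$, $s\in S$, and if $rs=0$ with $r\in R$, $s\in S$ implies $tr=0$ for some $t\in S$. Let $\max\mathbb{L}_l(R)$ and $\max\mathrm{Den}_l(R)$ be the sets of maximal (with respect to inclusion) left localizable sets and of maximal left denominator sets of $R$, let $\min(R)$ be the set of minimal prime (two-sided) ideals of $R$, and put $\mathcal{C}(\mathfrak{p})=\{c\in R \mid c+\mathfrak{p}\in\mathcal{C}_{R/\mathfrak{p}}\}$.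 **Theorem.** Let $R$ be a semiprime left Goldie ring (semiprime, of finite left uniform dimension, and with the ascending chain condition on left annihilators). Then $$\{S\in\max\mathbb{L}_l(R) \mid \mathcal{C}_R\subseteq S\}=\max\mathrm{Den}_l(R)=\{\mathcal{C}(\mathfrak{p}) \mid \mathfrak{p}\in\min(R)\}.$$ -/

import Mathlib

universe u v w

/-! ### Semiprime left Goldie rings -/

/-- A ring is semiprime if `a R a = 0` implies `a = 0`. -/
def IsSemiprimeRing (R : Type u) [Ring R] : Prop :=
  ∀ a : R, (∀ r : R, a * r * a = 0) → a = 0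

/-- The left annihilator `{r | r x = 0 for all x ∈ X}`, a left ideal. -/
def leftAnnihilator {R : Type u} [Ring R] (X : Set R) : Ideal R where
  carrier := {r | ∀ x ∈ X, r * x = 0}
  zero_mem' := fun x _ => zero_mul x
  add_mem' := fun {a b} ha hb x hx => by rw [add_mul, ha x hx, hb x hx, add_zero]
  smul_mem' := fun c r hr x hx => by rw [smul_eq_mul, mul_assoc, hr x hx, mul_zero]

/-- `R` has finite left uniform dimension: there is no infinite direct sum of nonzero left
ideals in `R`. -/
def HasFiniteLeftUniformDim (R : Type u) [Ring R] : Prop :=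
  ¬ ∃ J : ℕ → Ideal R, (∀ n, J n ≠ ⊥) ∧ iSupIndep J

/-- The ascending chain condition on left annihilators. -/
def HasACCLeftAnnihilators (R : Type u) [Ring R] : Prop :=
  WellFoundedGT {J : Ideal R // ∃ X : Set R, J = leftAnnihilator X}

/-- A left Goldie ring: finite left uniform dimension and the ascending chain condition on left
annihilators. -/
structure IsLeftGoldieRing (R : Type u) [Ring R] : Prop where
  finite_udim : HasFiniteLeftUniformDim R
  acc_leftAnnihilators : HasACCLeftAnnihilators R

/-! ### Minimal primes and the sets `C(p)` -/

/-- A prime (two-sided) ideal of a not necessarily commutative ring: `P ≠ R`, and `a R b ⊆ P`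
implies `a ∈ P` or `b ∈ P`. -/
def IsPrimeTwoSided {R : Type u} [Ring R] (P : TwoSidedIdeal R) : Prop :=
  P ≠ ⊤ ∧ ∀ a b : R, (∀ r : R, a * r * b ∈ P) → a ∈ P ∨ b ∈ P

/-- The set `min(R)` of minimal prime ideals of `R`. -/
def minPrimes (R : Type u) [Ring R] : Set (TwoSidedIdeal R) :=
  {P | Minimal IsPrimeTwoSided P}

/-- `C(p) = {c ∈ R | c + p is a regular element of R/p}`, where regular means neither a left nor
a right zero divisor. -/
def regularModulo {R : Type u} [Ring R] (p : TwoSidedIdeal R) : Submonoid R :=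
  (nonZeroDivisors p.ringCon.Quotient).comap p.ringCon.mk'

/-! ### Left denominator sets -/

/-- A left denominator set: a multiplicative set (a submonoid without `0`) that is a left Ore set
and such that `r s = 0` with `s ∈ S` implies `t r = 0` for some `t ∈ S`. The last two properties
are what `OreLocalization.OreSet` records, see `isLeftDenominatorSet_iff`. -/
def IsLeftDenominatorSet {R : Type u} [Ring R] (S : Submonoid R) : Prop :=
  (0 : R) ∉ S ∧ Nonempty (OreLocalization.OreSet S)

theorem isLeftDenominatorSet_iff {R : Type u} [Ring R] (S : Submonoid R) :
    IsLeftDenominatorSet S ↔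
      (0 : R) ∉ S ∧
      (∀ r : R, ∀ s ∈ S, ∃ s' ∈ S, ∃ r' : R, s' * r = r' * s) ∧
      (∀ r : R, ∀ s ∈ S, r * s = 0 → ∃ t ∈ S, t * r = 0) := by
  refine and_congr_right fun _ => ⟨?_, ?_⟩
  · rintro ⟨h⟩
    refine ⟨fun r s hs => ⟨_, (h.oreDenom r ⟨s, hs⟩).2, _, h.ore_eq r ⟨s, hs⟩⟩, fun r s hs h0 => ?_⟩
    obtain ⟨t, ht⟩ := h.ore_right_cancel r 0 ⟨s, hs⟩ (by simpa using h0)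
    exact ⟨t, t.2, by simpa using ht⟩
  · rintro ⟨h₁, h₂⟩
    choose d hd n hn using h₁
    refine ⟨⟨fun r₁ r₂ s h => ?_, fun r s => n r s s.2, fun r s => ⟨d r s s.2, hd r s s.2⟩,
      fun r s => hn r s s.2⟩⟩
    obtain ⟨t, ht, h0⟩ := h₂ (r₁ - r₂) s s.2 (by rw [sub_mul, h, sub_self])
    exact ⟨⟨t, ht⟩, by rwa [mul_sub, sub_eq_zero] at h0⟩

/-! ### The rings `R⟨X⟩` and `R⟨S⁻¹⟩` -/

/-- The relations saying that `R → R⟨X⟩` is a homomorphism of `K`-algebras. -/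
inductive FreeExtRel (K : Type v) (R : Type u) [CommRing K] [Ring R] [Algebra K R] (X : Type w) :
    FreeAlgebra K (R ⊕ X) → FreeAlgebra K (R ⊕ X) → Prop
  | add (a b : R) : FreeExtRel K R X (FreeAlgebra.ι K (Sum.inl (a + b)))
      (FreeAlgebra.ι K (Sum.inl a) + FreeAlgebra.ι K (Sum.inl b))
  | mul (a b : R) : FreeExtRel K R X (FreeAlgebra.ι K (Sum.inl (a * b)))
      (FreeAlgebra.ι K (Sum.inl a) * FreeAlgebra.ι K (Sum.inl b))
  | scalar (k : K) : FreeExtRel K R X (FreeAlgebra.ι K (Sum.inl (algebraMap K R k)))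
      (algebraMap K (FreeAlgebra K (R ⊕ X)) k)

/-- The `K`-algebra `R⟨X⟩` freely generated by the `K`-algebra `R` and a set `X` of free
noncommuting indeterminates. -/
abbrev FreeExt (K : Type v) (R : Type u) [CommRing K] [Ring R] [Algebra K R] (X : Type w) :
    Type (max u v w) :=
  RingQuot (FreeExtRel K R X)

namespace FreeExt

/-- The canonical homomorphism `R → R⟨X⟩`. -/
noncomputable def incl (K : Type v) (R : Type u) [CommRing K] [Ring R] [Algebra K R]
    (X : Type w) : R →ₐ[K] FreeExt K R X :=
  have hscalar : ∀ k : K, RingQuot.mkAlgHom K (FreeExtRel K R X)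
      (FreeAlgebra.ι K (Sum.inl (algebraMap K R k))) = algebraMap K (FreeExt K R X) k := fun k => by
    rw [RingQuot.mkAlgHom_rel K (FreeExtRel.scalar k), AlgHom.commutes]
  { toFun := fun r => RingQuot.mkAlgHom K (FreeExtRel K R X) (FreeAlgebra.ι K (Sum.inl r))
    map_one' := by simpa using hscalar 1
    map_mul' := fun a b => by
      rw [RingQuot.mkAlgHom_rel K (FreeExtRel.mul a b), map_mul]
    map_zero' := by simpa using hscalar 0
    map_add' := fun a b => by
      rw [RingQuot.mkAlgHom_rel K (FreeExtRel.add a b), map_add]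
    commutes' := hscalar }

/-- The indeterminate of `R⟨X⟩` with index `x`. -/
noncomputable def var (K : Type v) (R : Type u) [CommRing K] [Ring R] [Algebra K R]
    {X : Type w} (x : X) : FreeExt K R X :=
  RingQuot.mkAlgHom K (FreeExtRel K R X) (FreeAlgebra.ι K (Sum.inr x))

end FreeExt

/-- The relations `s x_s = 1` and `x_s s = 1` for `s ∈ S`. -/
inductive InvertRel (K : Type v) {R : Type u} [CommRing K] [Ring R] [Algebra K R]
    (S : Submonoid R) : FreeExt K R S → FreeExt K R S → Prop
  | mul_inv (s : S) : InvertRel K S (FreeExt.incl K R S s * FreeExt.var K R s) 1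
  | inv_mul (s : S) : InvertRel K S (FreeExt.var K R s * FreeExt.incl K R S s) 1

/-- The ring `R⟨S⁻¹⟩`, the quotient of `R⟨X_S⟩` by the ideal generated by all the elements
`s x_s - 1` and `x_s s - 1`, `s ∈ S`. -/
abbrev Inverted (K : Type v) {R : Type u} [CommRing K] [Ring R] [Algebra K R]
    (S : Submonoid R) : Type (max u v) :=
  RingQuot (InvertRel K S)

namespace Inverted

/-- The canonical homomorphism `R → R⟨S⁻¹⟩`. -/
noncomputable def of (K : Type v) {R : Type u} [CommRing K] [Ring R] [Algebra K R]
    (S : Submonoid R) : R →ₐ[K] Inverted K S :=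
  (RingQuot.mkAlgHom K (InvertRel K S)).comp (FreeExt.incl K R S)

/-- The element `x_s` of `R⟨S⁻¹⟩`, the inverse of the image of `s`. -/
noncomputable def inv (K : Type v) {R : Type u} [CommRing K] [Ring R] [Algebra K R]
    (S : Submonoid R) (s : S) : Inverted K S :=
  RingQuot.mkAlgHom K (InvertRel K S) (FreeExt.var K R s)

end Inverted

/-- A left localizable set: a multiplicative set `S` (a submonoid without `0`) such that the ring
`R⟨S⁻¹⟩` is nonzero and each of its elements is a left fraction, that is, the product of the
inverse of the image of some `s ∈ S` and of the image of some `r ∈ R`. -/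
structure IsLeftLocalizableSet (K : Type v) {R : Type u} [CommRing K] [Ring R] [Algebra K R]
    (S : Submonoid R) : Prop where
  zero_notMem : (0 : R) ∉ S
  nontrivial : Nontrivial (Inverted K S)
  exists_fraction : ∀ z : Inverted K S, ∃ (s : S) (r : R), z = Inverted.inv K S s * Inverted.of K S r

/-!
In a semiprime left Goldie ring every essential left ideal contains a regular element, and the
minimal primes are of the form `p = ann b` with `b` a two-sided ideal. As `b ⊕ ann b` is essential,
it contains a regular element, whose component in `b` lies in `C(p)`. For `c ∈ C(p)` right
multiplication by `c` is injective on `b`, so `b c` is essential in `b` by finiteness of the uniform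
dimension, and `b c ⊕ ann b` is essential in `R`; this gives the left Ore condition for `C(p)`.

Conversely, if a homomorphism `φ` inverts `S` and kills no regular element, then `ker φ` lies in
some minimal prime `p = ann b`. Since `b ∩ ker φ = 0`, the elements of `S` act injectively on `b`
from both sides, that is, `S ⊆ C(p)`. This applies to the Ore localization at a left denominator set
and to `R → R⟨S⁻¹⟩` if `S` contains all regular elements. The sets `C(p)` are pairwise incomparable,
so they are exactly the maximal elements on both sides.
-/

section Order

variable {α : Type*} [PartialOrder α]

theorem setOf_maximal_eq_of_isAntichain {P : α → Prop} {s : Set α} (hs : IsAntichain (· ≤ ·) s)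
    (hP : ∀ a ∈ s, P a) (hle : ∀ b, P b → ∃ a ∈ s, b ≤ a) : {b | Maximal P b} = s := by
  refine Set.Subset.antisymm (fun b hb => ?_) fun a ha => ⟨hP a ha, fun b hb hab => ?_⟩
  · obtain ⟨a, ha, hba⟩ := hle b hb.prop
    rwa [hb.eq_of_le (hP a ha) hba]
  · obtain ⟨a', ha', hba'⟩ := hle b hb
    rwa [hs.eq ha ha' (hab.trans hba')]

theorem maximal_and_le_iff {P : α → Prop} {a c : α} :
    Maximal P a ∧ c ≤ a ↔ Maximal (fun x => P x ∧ c ≤ x) a :=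
  ⟨fun ⟨ha, hc⟩ => ⟨⟨ha.prop, hc⟩, fun _ hb => ha.le_of_ge hb.1⟩,
    fun ha => ⟨⟨ha.prop.1, fun _ hb hab => ha.le_of_ge ⟨hb, ha.prop.2.trans hab⟩ hab⟩, ha.prop.2⟩⟩

end Order

section Module

variable {R M M' : Type*} [Ring R] [AddCommGroup M] [Module R M] [AddCommGroup M'] [Module R M']

theorem iSupIndep_of_antitone_of_disjoint {L J : ℕ → Submodule R M} (hL : Antitone L)
    (hJ : ∀ n, J n ≤ L n) (hd : ∀ n, Disjoint (J n) (L (n + 1))) : iSupIndep J := by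
  rw [iSupIndep_iff_finsetSum_eq_zero_imp_eq_zero]
  intro s v hv hsum i
  induction i using Nat.strong_induction_on with
  | _ i ih =>
    intro hi
    have hvi : v i = -∑ j ∈ s.erase i, v j :=
      eq_neg_of_add_eq_zero_left ((s.add_sum_erase v hi).trans hsum)
    have htail : v i ∈ L (i + 1) := by
      rw [hvi]
      refine neg_mem (sum_mem fun j hj => ?_)
      obtain ⟨hji, hjs⟩ := Finset.mem_erase.1 hj
      rcases lt_or_gt_of_ne hji with hlt | hgt
      · rw [ih j hlt hjs]
        exact zero_mem _
      · exact hL hgt (hJ j (hv j hjs))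
    exact Submodule.disjoint_def.1 (hd i) _ (hv i hi) htail

/-- `N` meets every nonzero submodule of `L`. When `N ≤ L` this says that `N` is an essential
submodule of `L`; the inclusion is not part of the definition, so that `IsEssentialIn` is monotone
in `N`. -/
def IsEssentialIn (N L : Submodule R M) : Prop :=
  ∀ J ≤ L, Disjoint J N → J = ⊥

namespace IsEssentialIn

theorem refl (N : Submodule R M) : IsEssentialIn N N := fun _ hJ hd => hd.eq_bot_of_le hJ

variable {N N' L : Submodule R M}

theorem mono (h : IsEssentialIn N L) (hN : N ≤ N') : IsEssentialIn N' L :=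
  fun J hJ hd => h J hJ (hd.mono_right hN)

theorem comap (h : IsEssentialIn N L) (f : M' →ₗ[R] M) :
    IsEssentialIn (N.comap f) (L.comap f) := by
  intro J hJ hd
  have hmap : J.map f = ⊥ := by
    refine h _ (Submodule.map_le_iff_le_comap.2 hJ) (Submodule.disjoint_def.2 ?_)
    rintro _ ⟨x, hx, rfl⟩ hfx
    rw [Submodule.disjoint_def.1 hd x hx hfx, map_zero]
  exact hd.eq_bot_of_le (Submodule.map_le_iff_le_comap.1 (hmap.trans_le bot_le))

end IsEssentialIn

end Module

namespace HasFiniteLeftUniformDim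

variable {R : Type*} [Ring R]

theorem wellFounded_le_and_not_isEssentialIn (h : HasFiniteLeftUniformDim R) :
    WellFounded fun N L : Ideal R => N ≤ L ∧ ¬ IsEssentialIn N L := by
  refine wellFounded_iff_isEmpty_descending_chain.2 ⟨fun ⟨L, hL⟩ => h ?_⟩
  have hcompl : ∀ n, ∃ J ≤ L n, Disjoint J (L (n + 1)) ∧ J ≠ ⊥ := fun n => by
    simpa only [IsEssentialIn, not_forall, exists_prop] using (hL n).2
  choose J hJ hd hne using hcompl
  exact ⟨J, hne, iSupIndep_of_antitone_of_disjoint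
    (antitone_nat_of_succ_le fun n => (hL n).1) hJ hd⟩

-- Some `(f ^ (n + 1)) I` is essential in `(f ^ n) I`, and this is pulled back along `f ^ n`.
theorem isEssentialIn_map (h : HasFiniteLeftUniformDim R) {I : Ideal R} {f : R →ₗ[R] R}
    (hI : I ≤ Submodule.comap f I) (hf : Set.InjOn f I) :
    IsEssentialIn (Submodule.map f I) I := by
  obtain ⟨_, ⟨n, rfl⟩, hmin⟩ := h.wellFounded_le_and_not_isEssentialIn.has_min
    (Set.range fun n : ℕ => Submodule.map (f ^ n) I) (Set.range_nonempty _)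
  have hle : Submodule.map (f ^ (n + 1)) I ≤ Submodule.map (f ^ n) I := by
    rw [pow_succ, Module.End.mul_eq_comp, Submodule.map_comp]
    exact Submodule.map_mono (Submodule.map_le_iff_le_comap.2 hI)
  have hess : IsEssentialIn (Submodule.map (f ^ (n + 1)) I) (Submodule.map (f ^ n) I) :=
    not_not.1 fun hn => hmin _ ⟨n + 1, rfl⟩ ⟨hle, hn⟩
  have hinj : Set.InjOn (f ^ n : R →ₗ[R] R) I := by
    rw [Module.End.coe_pow]
    exact hf.iterate hI n
  refine fun J hJ hd => hess.comap (f ^ n) J (hJ.trans (Submodule.le_comap_map _ _)) ?_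
  refine Submodule.disjoint_def.2 fun x hx hfx => ?_
  obtain ⟨y, hy, hyx : (f ^ (n + 1)) y = (f ^ n) x⟩ := hfx
  rw [pow_succ, Module.End.mul_apply] at hyx
  exact Submodule.disjoint_def.1 hd x hx ⟨y, hy, hinj (hI hy) (hJ hx) hyx⟩

end HasFiniteLeftUniformDim

section LeftAnnihilator

variable {R : Type*} [Ring R]

theorem mem_leftAnnihilator_singleton {c x : R} : x ∈ leftAnnihilator {c} ↔ x * c = 0 :=
  forall_eq

theorem disjoint_span_leftAnnihilator_iff {a : R} :
    Disjoint (Ideal.span {a}) (leftAnnihilator {a}) ↔ ∀ x, x * a * a = 0 → x * a = 0 := by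
  simp only [Submodule.disjoint_def, Ideal.mem_span_singleton', mem_leftAnnihilator_singleton,
    forall_exists_index, forall_apply_eq_imp_iff]

theorem HasACCLeftAnnihilators.exists_maximalFor (h : HasACCLeftAnnihilators R) {ι : Type*}
    (X : ι → Set R) {P : ι → Prop} (hP : ∃ i, P i) :
    ∃ i, MaximalFor P (fun i => leftAnnihilator (X i)) i := by
  have : WellFoundedGT {J : Ideal R // ∃ X : Set R, J = leftAnnihilator X} := h
  exact exists_maximalFor_of_wellFoundedGT P
    (fun i => (⟨leftAnnihilator (X i), X i, rfl⟩ : {J : Ideal R // ∃ X, J = leftAnnihilator X})) hP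

theorem leftAnnihilator_singleton_add {a c : R} (hac : a * c = 0)
    (hc : Disjoint (Ideal.span {c}) (leftAnnihilator {c})) :
    leftAnnihilator {c + a} = leftAnnihilator {c} ⊓ leftAnnihilator {a} := by
  ext x
  simp only [Submodule.mem_inf, mem_leftAnnihilator_singleton]
  refine ⟨fun hx => ?_, fun ⟨hxc, hxa⟩ => by rw [mul_add, hxc, hxa, add_zero]⟩
  have hxc : x * c = 0 := disjoint_span_leftAnnihilator_iff.1 hc x <| by
    calc x * c * c = x * (c + a) * c - x * (a * c) := by noncomm_ring
      _ = 0 := by rw [hx, hac, zero_mul, mul_zero, sub_zero]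
  exact ⟨hxc, by rwa [mul_add, hxc, zero_add] at hx⟩

theorem disjoint_span_leftAnnihilator_add {a c : R} (hac : a * c = 0)
    (hc : Disjoint (Ideal.span {c}) (leftAnnihilator {c}))
    (ha : Disjoint (Ideal.span {a}) (leftAnnihilator {a})) :
    Disjoint (Ideal.span {c + a}) (leftAnnihilator {c + a}) := by
  rw [disjoint_span_leftAnnihilator_iff]
  intro x hx
  rw [← mem_leftAnnihilator_singleton, leftAnnihilator_singleton_add hac hc, Submodule.mem_inf,
    mem_leftAnnihilator_singleton, mem_leftAnnihilator_singleton] at hx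
  obtain ⟨hxcc, hxa⟩ := hx
  have hxc : x * c = 0 := disjoint_span_leftAnnihilator_iff.1 hc x <| by
    rwa [mul_add, add_mul, mul_assoc x a c, hac, mul_zero, add_zero] at hxcc
  rw [mul_add, hxc, zero_add] at hxa ⊢
  exact disjoint_span_leftAnnihilator_iff.1 ha x hxa

end LeftAnnihilator

namespace IsSemiprimeRing

variable {R : Type*} [Ring R]

theorem mul_mul_eq_zero_comm (hs : IsSemiprimeRing R) {x y : R} :
    (∀ r, x * r * y = 0) ↔ ∀ r, y * r * x = 0 := by
  suffices h : ∀ {x y : R}, (∀ r, x * r * y = 0) → ∀ r, y * r * x = 0 from ⟨h, h⟩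
  intro x y hxy r
  refine hs _ fun t => ?_
  calc y * r * x * t * (y * r * x) = y * r * (x * t * y) * r * x := by noncomm_ring
    _ = 0 := by rw [hxy, mul_zero, zero_mul, zero_mul]

-- If all `r * a` are nilpotent for some `a` with maximal annihilator, then
-- `x = a * (r * a) ^ k ≠ 0 = a * (r * a) ^ (k + 1)` has the same annihilator as `a`, and it is
-- killed by `a * r`; so `a * r * a = 0` for all `r`.
theorem exists_mem_not_isNilpotent (hs : IsSemiprimeRing R) (hacc : HasACCLeftAnnihilators R)
    {E : Ideal R} (hE : E ≠ ⊥) : ∃ a ∈ E, ¬ IsNilpotent a := by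
  by_contra! hnil
  obtain ⟨a, ⟨ha, ha0⟩, hmax⟩ := hacc.exists_maximalFor (fun a : R => {a})
    ((Submodule.ne_bot_iff E).1 hE)
  refine ha0 (hs a fun r => ?_)
  have hex : ∃ k : ℕ, a * (r * a) ^ k = 0 :=
    (hnil (r * a) (E.mul_mem_left r ha)).imp fun k hk => by rw [hk, mul_zero]
  obtain ⟨k, hk, hk'⟩ : ∃ k : ℕ, a * (r * a) ^ k ≠ 0 ∧ a * (r * a) ^ (k + 1) = 0 := by
    by_contra! hstep
    obtain ⟨k, hk⟩ := hex
    exact Nat.rec (by simpa using ha0) hstep k hk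
  have hmem : a * (r * a) ^ k ∈ E := by
    rw [← mul_pow_mul]
    exact E.mul_mem_left _ ha
  have hle : leftAnnihilator {a} ≤ leftAnnihilator {a * (r * a) ^ k} := fun z hz => by
    rw [mem_leftAnnihilator_singleton] at hz ⊢
    rw [← mul_assoc, hz, zero_mul]
  refine mem_leftAnnihilator_singleton.1 (hmax ⟨hmem, hk⟩ hle ?_)
  rw [mem_leftAnnihilator_singleton, ← hk', pow_succ']
  simp only [mul_assoc]

theorem exists_disjoint_span_leftAnnihilator (hs : IsSemiprimeRing R)
    (hacc : HasACCLeftAnnihilators R) {E : Ideal R} (hE : E ≠ ⊥) :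
    ∃ a ∈ E, a ≠ 0 ∧ Disjoint (Ideal.span {a}) (leftAnnihilator {a}) := by
  obtain ⟨u, hu, hnil⟩ := hs.exists_mem_not_isNilpotent hacc hE
  obtain ⟨n, hn, hmax⟩ := hacc.exists_maximalFor (fun n : ℕ => {u ^ n}) (P := (0 < ·))
    ⟨1, one_pos⟩
  refine ⟨u ^ n, E.pow_mem_of_mem hu n hn, fun h => hnil ⟨n, h⟩,
    disjoint_span_leftAnnihilator_iff.2 fun x hx => ?_⟩
  have hle : leftAnnihilator {u ^ n} ≤ leftAnnihilator {u ^ (n + n)} := fun z hz => by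
    rw [mem_leftAnnihilator_singleton] at hz ⊢
    rw [pow_add, ← mul_assoc, hz, zero_mul]
  refine mem_leftAnnihilator_singleton.1 (hmax (Nat.add_pos_left hn n) hle ?_)
  rwa [mem_leftAnnihilator_singleton, pow_add, ← mul_assoc]

theorem eq_zero_of_isEssentialIn_leftAnnihilator (hs : IsSemiprimeRing R)
    (hacc : HasACCLeftAnnihilators R) {z : R} (hz : IsEssentialIn (leftAnnihilator {z}) ⊤) :
    z = 0 := by
  by_contra h0
  obtain ⟨a, ha, ha0, hdisj⟩ := hs.exists_disjoint_span_leftAnnihilator hacc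
    (mt Ideal.span_singleton_eq_bot.1 h0)
  obtain ⟨r, rfl⟩ := Ideal.mem_span_singleton'.1 ha
  have hess : IsEssentialIn (leftAnnihilator {r * z}) ⊤ :=
    (hz.comap (LinearMap.toSpanSingleton R R r)).mono fun x hx => by
      rw [Submodule.mem_comap, mem_leftAnnihilator_singleton] at hx
      rwa [mem_leftAnnihilator_singleton, ← mul_assoc]
  exact ha0 (Ideal.span_singleton_eq_bot.1 (hess _ le_top hdisj))

-- Enlarging `c` to `c + a` cuts `leftAnnihilator {c}` down to a nonessential left ideal, so the
-- process stops.
theorem exists_mem_leftAnnihilator_eq_bot (hs : IsSemiprimeRing R) (hg : IsLeftGoldieRing R)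
    {E : Ideal R} (hE : IsEssentialIn E ⊤) : ∃ c ∈ E, leftAnnihilator {c} = ⊥ := by
  have hwf := InvImage.wf (fun c : R => leftAnnihilator {c})
    hg.finite_udim.wellFounded_le_and_not_isEssentialIn
  obtain ⟨c, ⟨hcE, hc⟩, hmin⟩ := hwf.has_min
    {c | c ∈ E ∧ Disjoint (Ideal.span {c}) (leftAnnihilator {c})} ⟨0, E.zero_mem, by simp⟩
  refine ⟨c, hcE, hE _ le_top (disjoint_iff.2 ?_)⟩
  by_contra hne
  obtain ⟨a, ⟨hac, haE⟩, ha0, ha⟩ :=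
    hs.exists_disjoint_span_leftAnnihilator hg.acc_leftAnnihilators hne
  have hac' : a * c = 0 := mem_leftAnnihilator_singleton.1 hac
  refine hmin (c + a) ⟨E.add_mem hcE haE, disjoint_span_leftAnnihilator_add hac' hc ha⟩ ?_
  rw [InvImage, leftAnnihilator_singleton_add hac' hc]
  refine ⟨inf_le_left, fun hess => ha0 (Ideal.span_singleton_eq_bot.1 ?_)⟩
  exact hess _ ((Ideal.span_singleton_le_iff_mem _).2 hac) (ha.mono_right inf_le_right)

theorem mem_nonZeroDivisors_of_leftAnnihilator_eq_bot (hs : IsSemiprimeRing R)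
    (hg : IsLeftGoldieRing R) {c : R} (hc : leftAnnihilator {c} = ⊥) : c ∈ nonZeroDivisors R := by
  have hright : ∀ x, x * c = 0 → x = 0 := fun x hx => by
    rwa [← mem_leftAnnihilator_singleton, hc, Submodule.mem_bot] at hx
  refine ⟨fun y hy => hs.eq_zero_of_isEssentialIn_leftAnnihilator hg.acc_leftAnnihilators ?_,
    hright⟩
  have hinj : Function.Injective (LinearMap.toSpanSingleton R R c) :=
    (injective_iff_map_eq_zero _).2 hright
  refine (hg.finite_udim.isEssentialIn_map (I := ⊤) le_top hinj.injOn).mono ?_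
  rintro _ ⟨x, -, rfl⟩
  rw [mem_leftAnnihilator_singleton, LinearMap.toSpanSingleton_apply, smul_eq_mul, mul_assoc, hy,
    mul_zero]

end IsSemiprimeRing

theorem IsEssentialIn.exists_mem_nonZeroDivisors {R : Type*} [Ring R] {E : Ideal R}
    (hE : IsEssentialIn E ⊤) (hs : IsSemiprimeRing R) (hg : IsLeftGoldieRing R) :
    ∃ c ∈ E, c ∈ nonZeroDivisors R := by
  obtain ⟨c, hcE, hc⟩ := hs.exists_mem_leftAnnihilator_eq_bot hg hE
  exact ⟨c, hcE, hs.mem_nonZeroDivisors_of_leftAnnihilator_eq_bot hg hc⟩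

section TwoSidedAnnihilator

variable {R : Type*} [Ring R]

instance isTwoSided_leftAnnihilator (b : TwoSidedIdeal R) :
    (leftAnnihilator (b : Set R)).IsTwoSided :=
  ⟨fun r hx y hy => by rw [mul_assoc, hx _ (b.mul_mem_left r y hy)]⟩

/-- The left annihilator of a two-sided ideal, as a two-sided ideal. In a semiprime ring it is also
the right annihilator, see `IsSemiprimeRing.mem_twoSidedAnnihilator_iff_right`. -/
def twoSidedAnnihilator (b : TwoSidedIdeal R) : TwoSidedIdeal R :=
  (leftAnnihilator (b : Set R)).toTwoSided

theorem mem_twoSidedAnnihilator {b : TwoSidedIdeal R} {x : R} :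
    x ∈ twoSidedAnnihilator b ↔ ∀ y ∈ b, x * y = 0 :=
  Ideal.mem_toTwoSided

theorem mem_twoSidedAnnihilator_span_singleton {x y : R} :
    x ∈ twoSidedAnnihilator (TwoSidedIdeal.span {y}) ↔ ∀ r, x * r * y = 0 := by
  rw [mem_twoSidedAnnihilator]
  refine ⟨fun h r => ?_, fun h z hz => ?_⟩
  · rw [mul_assoc]
    exact h _ (TwoSidedIdeal.mul_mem_left _ r y (TwoSidedIdeal.subset_span rfl))
  · induction hz using TwoSidedIdeal.span_induction generalizing x with
    | mem z hz => simpa [Set.mem_singleton_iff.1 hz] using h 1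
    | zero => exact mul_zero x
    | add z w _ _ hz hw => rw [mul_add, hz h, hw h, add_zero]
    | neg z _ hz => rw [mul_neg, hz h, neg_zero]
    | left_absorb r z _ hz =>
      rw [← mul_assoc]
      exact hz fun t => by rw [mul_assoc x, h]
    | right_absorb r z _ hz => rw [← mul_assoc, hz h, zero_mul]

theorem twoSidedAnnihilator_eq_top_iff {b : TwoSidedIdeal R} :
    twoSidedAnnihilator b = ⊤ ↔ b = ⊥ := by
  rw [← TwoSidedIdeal.one_mem_iff, mem_twoSidedAnnihilator, ← le_bot_iff]
  simp only [one_mul, TwoSidedIdeal.le_iff, Set.subset_def, SetLike.mem_coe, TwoSidedIdeal.mem_bot]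

theorem twoSidedAnnihilator_antitone :
    Antitone (twoSidedAnnihilator : TwoSidedIdeal R → TwoSidedIdeal R) :=
  fun _ _ hab _ hx => mem_twoSidedAnnihilator.2 fun y hy => mem_twoSidedAnnihilator.1 hx y (hab hy)

theorem HasACCLeftAnnihilators.exists_maximalFor_twoSidedAnnihilator
    (h : HasACCLeftAnnihilators R) {P : TwoSidedIdeal R → Prop} (hP : ∃ b, P b) :
    ∃ b, MaximalFor P twoSidedAnnihilator b := by
  have hle : ∀ b c : TwoSidedIdeal R, twoSidedAnnihilator b ≤ twoSidedAnnihilator c ↔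
      leftAnnihilator (b : Set R) ≤ leftAnnihilator (c : Set R) := fun b c => by
    simp only [TwoSidedIdeal.le_iff, twoSidedAnnihilator, Ideal.coe_toTwoSided,
      SetLike.coe_subset_coe]
  simpa only [MaximalFor, hle] using
    h.exists_maximalFor (fun b : TwoSidedIdeal R => (b : Set R)) hP

namespace IsSemiprimeRing

variable {a b : TwoSidedIdeal R} {x : R}

theorem mem_twoSidedAnnihilator_iff_right (hs : IsSemiprimeRing R) :
    x ∈ twoSidedAnnihilator b ↔ ∀ y ∈ b, y * x = 0 := by
  refine mem_twoSidedAnnihilator.trans ⟨fun h y hy => ?_, fun h y hy => ?_⟩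
  · simpa using hs.mul_mul_eq_zero_comm.1
      (fun r => by rw [mul_assoc, h _ (b.mul_mem_left r y hy)]) 1
  · simpa using hs.mul_mul_eq_zero_comm.1 (fun r => h _ (b.mul_mem_right y r hy)) 1

theorem le_twoSidedAnnihilator_comm (hs : IsSemiprimeRing R) :
    a ≤ twoSidedAnnihilator b ↔ b ≤ twoSidedAnnihilator a := by
  suffices h : ∀ {a b : TwoSidedIdeal R}, a ≤ twoSidedAnnihilator b → b ≤ twoSidedAnnihilator a
    from ⟨h, h⟩
  exact fun hab x hx => hs.mem_twoSidedAnnihilator_iff_right.2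
    fun y hy => mem_twoSidedAnnihilator.1 (hab hy) x hx

theorem eq_zero_of_mem_of_mem_twoSidedAnnihilator (hs : IsSemiprimeRing R) (hb : x ∈ b)
    (hx : x ∈ twoSidedAnnihilator b) : x = 0 :=
  hs x fun r => by rw [mul_assoc, mem_twoSidedAnnihilator.1 hx _ (b.mul_mem_left r x hb)]

theorem disjoint_twoSidedAnnihilator (hs : IsSemiprimeRing R) (b : TwoSidedIdeal R) :
    Disjoint b (twoSidedAnnihilator b) :=
  disjoint_iff_inf_le.2 fun _ hx => (TwoSidedIdeal.mem_bot R).2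
    (hs.eq_zero_of_mem_of_mem_twoSidedAnnihilator hx.1 hx.2)

end IsSemiprimeRing

end TwoSidedAnnihilator

section MinimalPrimes

variable {R : Type*} [Ring R]

theorem IsPrimeTwoSided.le_or_le {p a b : TwoSidedIdeal R} (hp : IsPrimeTwoSided p)
    (hab : ∀ x ∈ a, ∀ y ∈ b, x * y ∈ p) : a ≤ p ∨ b ≤ p := by
  refine or_iff_not_imp_left.2 fun ha y hy => ?_
  obtain ⟨x, hx, hxp⟩ := SetLike.not_le_iff_exists.1 ha
  exact (hp.2 x y fun r => hab _ (a.mul_mem_right x r hx) y hy).resolve_left hxp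

theorem IsPrimeTwoSided.twoSidedAnnihilator_le_or_le {p : TwoSidedIdeal R}
    (hp : IsPrimeTwoSided p) (b : TwoSidedIdeal R) : twoSidedAnnihilator b ≤ p ∨ b ≤ p :=
  hp.le_or_le fun x hx y hy => by
    rw [mem_twoSidedAnnihilator.1 hx y hy]
    exact p.zero_mem

theorem isPrimeTwoSided_twoSidedAnnihilator {b : TwoSidedIdeal R} (hb : b ≠ ⊥)
    (hmax : ∀ c ≤ b, c ≠ ⊥ → twoSidedAnnihilator c ≤ twoSidedAnnihilator b) :
    IsPrimeTwoSided (twoSidedAnnihilator b) := by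
  refine ⟨mt twoSidedAnnihilator_eq_top_iff.1 hb,
    fun x y hxy => or_iff_not_imp_right.2 fun hy => ?_⟩
  obtain ⟨w, hw, hyw⟩ : ∃ w ∈ b, y * w ≠ 0 := by
    simpa only [mem_twoSidedAnnihilator, not_forall, exists_prop] using hy
  have hle : TwoSidedIdeal.span {y * w} ≤ b :=
    TwoSidedIdeal.span_le.2 (Set.singleton_subset_iff.2 (b.mul_mem_left y w hw))
  have hne : TwoSidedIdeal.span {y * w} ≠ ⊥ := fun h =>
    hyw ((TwoSidedIdeal.mem_bot R).1 (h ▸ TwoSidedIdeal.subset_span rfl))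
  refine hmax _ hle hne (mem_twoSidedAnnihilator_span_singleton.2 fun r => ?_)
  rw [← mul_assoc, mem_twoSidedAnnihilator.1 (hxy r) w hw]

namespace IsSemiprimeRing

theorem mem_minPrimes_of_isPrimeTwoSided_twoSidedAnnihilator (hs : IsSemiprimeRing R)
    {b : TwoSidedIdeal R} (hb : IsPrimeTwoSided (twoSidedAnnihilator b)) :
    twoSidedAnnihilator b ∈ minPrimes R := by
  refine ⟨hb, fun q hq hqb => ?_⟩
  exact (hq.twoSidedAnnihilator_le_or_le b).resolve_right fun hbq =>
    hb.1 (twoSidedAnnihilator_eq_top_iff.2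
      ((hs.disjoint_twoSidedAnnihilator b).eq_bot_of_le (hbq.trans hqb)))

theorem exists_twoSidedAnnihilator_mem_minPrimes (hs : IsSemiprimeRing R)
    (hacc : HasACCLeftAnnihilators R) {x : R} (hx : x ≠ 0) :
    ∃ b, twoSidedAnnihilator b ∈ minPrimes R ∧ x ∉ twoSidedAnnihilator b := by
  have hspan : TwoSidedIdeal.span {x} ≠ ⊥ := fun h =>
    hx ((TwoSidedIdeal.mem_bot R).1 (h ▸ TwoSidedIdeal.subset_span rfl))
  obtain ⟨b, ⟨hbx, hb⟩, hmax⟩ := hacc.exists_maximalFor_twoSidedAnnihilator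
    (P := fun b => b ≤ TwoSidedIdeal.span {x} ∧ b ≠ ⊥) ⟨_, le_rfl, hspan⟩
  have hprime : IsPrimeTwoSided (twoSidedAnnihilator b) :=
    isPrimeTwoSided_twoSidedAnnihilator hb fun c hcb hc =>
      hmax ⟨hcb.trans hbx, hc⟩ (twoSidedAnnihilator_antitone hcb)
  refine ⟨b, hs.mem_minPrimes_of_isPrimeTwoSided_twoSidedAnnihilator hprime, fun hxb => hb ?_⟩
  exact (hs.disjoint_twoSidedAnnihilator b).eq_bot_of_le
    (hbx.trans (TwoSidedIdeal.span_le.2 (Set.singleton_subset_iff.2 hxb)))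

theorem exists_eq_twoSidedAnnihilator_of_mem_minPrimes (hs : IsSemiprimeRing R)
    (hacc : HasACCLeftAnnihilators R) {q : TwoSidedIdeal R} (hq : q ∈ minPrimes R) :
    ∃ b, q = twoSidedAnnihilator b := by
  obtain ⟨b, hbq, hmax⟩ := hacc.exists_maximalFor_twoSidedAnnihilator (P := fun b => ¬ b ≤ q)
    ⟨⊤, fun h => hq.prop.1 (top_le_iff.1 h)⟩
  obtain ⟨x, hxb, hxq⟩ := SetLike.not_le_iff_exists.1 hbq
  obtain ⟨c, hc, hxc⟩ := hs.exists_twoSidedAnnihilator_mem_minPrimes hacc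
    (ne_of_mem_of_not_mem q.zero_mem hxq).symm
  suffices hcq : twoSidedAnnihilator c ≤ q from ⟨c, (hq.eq_of_le hc.prop hcq).symm⟩
  by_contra hcq
  have hinf : ¬ b ⊓ twoSidedAnnihilator c ≤ q := fun h =>
    (hq.prop.le_or_le fun y hy z hz =>
      h ⟨b.mul_mem_right y z hy, TwoSidedIdeal.mul_mem_left _ y z hz⟩).elim hbq hcq
  have hann : c ≤ twoSidedAnnihilator b :=
    (hs.le_twoSidedAnnihilator_comm.2 inf_le_right).trans
      (hmax hinf (twoSidedAnnihilator_antitone inf_le_left))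
  exact hxc (hs.le_twoSidedAnnihilator_comm.1 hann hxb)

end IsSemiprimeRing

end MinimalPrimes

namespace IsSemiprimeRing

variable {R : Type*} [Ring R]

theorem isEssentialIn_sup_twoSidedAnnihilator (hs : IsSemiprimeRing R) {b : TwoSidedIdeal R}
    {E : Ideal R} (hE : IsEssentialIn E b.asIdeal) :
    IsEssentialIn (E ⊔ (twoSidedAnnihilator b).asIdeal) ⊤ := by
  intro J _ hd
  have hJb : J ⊓ b.asIdeal = ⊥ := hE _ inf_le_right (hd.mono inf_le_left le_sup_left)
  have hle : J ≤ (twoSidedAnnihilator b).asIdeal := fun x hx =>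
    TwoSidedIdeal.mem_asIdeal.2 <| hs.mem_twoSidedAnnihilator_iff_right.2 fun y hy =>
      (Submodule.eq_bot_iff _).1 hJb _ ⟨J.smul_mem y hx, b.mul_mem_right y x hy⟩
  exact hd.eq_bot_of_le (hle.trans le_sup_right)

theorem exists_mem_minPrimes_le (hs : IsSemiprimeRing R) (hg : IsLeftGoldieRing R)
    {a : TwoSidedIdeal R} (ha : ∀ c ∈ nonZeroDivisors R, c ∉ a) : ∃ p ∈ minPrimes R, a ≤ p := by
  have hann : twoSidedAnnihilator a ≠ ⊥ := fun h => by
    have hess : IsEssentialIn a.asIdeal ⊤ := by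
      simpa [h] using hs.isEssentialIn_sup_twoSidedAnnihilator (.refl a.asIdeal)
    obtain ⟨c, hca, hc⟩ := hess.exists_mem_nonZeroDivisors hs hg
    exact ha c hc (TwoSidedIdeal.mem_asIdeal.1 hca)
  obtain ⟨x, hx, hx0⟩ : ∃ x ∈ twoSidedAnnihilator a, x ≠ 0 := by
    simpa using SetLike.not_le_iff_exists.1 (mt le_bot_iff.1 hann)
  obtain ⟨b, hb, hxb⟩ := hs.exists_twoSidedAnnihilator_mem_minPrimes hg.acc_leftAnnihilators hx0
  exact ⟨_, hb, (hb.prop.twoSidedAnnihilator_le_or_le a).resolve_left fun h => hxb (h hx)⟩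

end IsSemiprimeRing

section RegularModulo

variable {R : Type*} [Ring R]

theorem mem_regularModulo {p : TwoSidedIdeal R} {c : R} :
    c ∈ regularModulo p ↔ (∀ x, c * x ∈ p → x ∈ p) ∧ ∀ x, x * c ∈ p → x ∈ p := by
  have hmk : ∀ x, p.ringCon.mk' x = 0 ↔ x ∈ p := fun x => by
    rw [← TwoSidedIdeal.mem_ker, TwoSidedIdeal.ker_ringCon_mk']
  simp only [regularModulo, Submonoid.mem_comap, mem_nonZeroDivisors_iff,
    (RingCon.mk'_surjective p.ringCon).forall, ← map_mul, hmk]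

theorem mem_regularModulo_iff_of_sub_mem {p : TwoSidedIdeal R} {c d : R} (h : c - d ∈ p) :
    c ∈ regularModulo p ↔ d ∈ regularModulo p := by
  have hmk : p.ringCon.mk' c = p.ringCon.mk' d :=
    (RingCon.eq _).2 ((TwoSidedIdeal.rel_iff p c d).2 h)
  rw [regularModulo, Submonoid.mem_comap, Submonoid.mem_comap, hmk]

theorem notMem_of_mem_regularModulo {p : TwoSidedIdeal R} (hp : p ≠ ⊤) {c : R}
    (hc : c ∈ regularModulo p) : c ∉ p := fun hcp =>
  hp (p.one_mem_iff.1 ((mem_regularModulo.1 hc).1 1 (p.mul_mem_right c 1 hcp)))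

namespace IsSemiprimeRing

variable {b : TwoSidedIdeal R}

theorem nonZeroDivisors_le_regularModulo_twoSidedAnnihilator (hs : IsSemiprimeRing R)
    (b : TwoSidedIdeal R) : nonZeroDivisors R ≤ regularModulo (twoSidedAnnihilator b) := by
  refine fun d hd => mem_regularModulo.2 ⟨fun x hx => ?_, fun x hx => ?_⟩
  · refine mem_twoSidedAnnihilator.2 fun z hz => hd.1 _ ?_
    rw [← mul_assoc, mem_twoSidedAnnihilator.1 hx z hz]
  · refine hs.mem_twoSidedAnnihilator_iff_right.2 fun z hz => hd.2 _ ?_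
    rw [mul_assoc, hs.mem_twoSidedAnnihilator_iff_right.1 hx z hz]

theorem exists_mem_regularModulo_twoSidedAnnihilator (hs : IsSemiprimeRing R)
    (hg : IsLeftGoldieRing R) (b : TwoSidedIdeal R) :
    ∃ e ∈ b, e ∈ regularModulo (twoSidedAnnihilator b) := by
  obtain ⟨d, hd, hreg⟩ := (hs.isEssentialIn_sup_twoSidedAnnihilator
    (.refl b.asIdeal)).exists_mem_nonZeroDivisors hs hg
  obtain ⟨e, he, z, hz, rfl⟩ := Submodule.mem_sup.1 hd
  refine ⟨e, he, (mem_regularModulo_iff_of_sub_mem ?_).1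
    (hs.nonZeroDivisors_le_regularModulo_twoSidedAnnihilator b hreg)⟩
  rwa [add_sub_cancel_left]

theorem isEssentialIn_map_toSpanSingleton (hs : IsSemiprimeRing R)
    (hfin : HasFiniteLeftUniformDim R) {c : R} (hc : c ∈ regularModulo (twoSidedAnnihilator b)) :
    IsEssentialIn (Submodule.map (LinearMap.toSpanSingleton R R c) b.asIdeal) b.asIdeal := by
  refine hfin.isEssentialIn_map (fun y hy => b.mul_mem_right y c hy) fun y hy z hz hyz => ?_
  replace hyz : y * c = z * c := hyz
  refine sub_eq_zero.1 (hs.eq_zero_of_mem_of_mem_twoSidedAnnihilator (b.sub_mem hy hz) ?_)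
  refine (mem_regularModulo.1 hc).2 _ ?_
  rw [sub_mul, hyz, sub_self]
  exact TwoSidedIdeal.zero_mem _

theorem exists_mul_eq_mul_of_mem_regularModulo (hs : IsSemiprimeRing R) (hg : IsLeftGoldieRing R)
    (r : R) {c : R} (hc : c ∈ regularModulo (twoSidedAnnihilator b)) :
    ∃ s ∈ regularModulo (twoSidedAnnihilator b), ∃ t, s * r = t * c := by
  have hess := (hs.isEssentialIn_sup_twoSidedAnnihilator
    (hs.isEssentialIn_map_toSpanSingleton hg.finite_udim hc)).comap
      (LinearMap.toSpanSingleton R R r)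
  obtain ⟨x, hx, hxreg⟩ := hess.exists_mem_nonZeroDivisors hs hg
  obtain ⟨_, ⟨y, -, rfl⟩, z, hz, hyz : y * c + z = x * r⟩ := Submodule.mem_sup.1 hx
  obtain ⟨e, heb, he⟩ := hs.exists_mem_regularModulo_twoSidedAnnihilator hg b
  refine ⟨e * x,
    mul_mem he (hs.nonZeroDivisors_le_regularModulo_twoSidedAnnihilator b hxreg), e * y, ?_⟩
  rw [mul_assoc, ← hyz, mul_add, hs.mem_twoSidedAnnihilator_iff_right.1 hz e heb, add_zero,
    mul_assoc]

theorem isLeftDenominatorSet_regularModulo_twoSidedAnnihilator (hs : IsSemiprimeRing R)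
    (hg : IsLeftGoldieRing R) (hb : b ≠ ⊥) :
    IsLeftDenominatorSet (regularModulo (twoSidedAnnihilator b)) := by
  have hzero : (0 : R) ∉ regularModulo (twoSidedAnnihilator b) := fun h =>
    notMem_of_mem_regularModulo (mt twoSidedAnnihilator_eq_top_iff.1 hb) h
      (TwoSidedIdeal.zero_mem _)
  refine (isLeftDenominatorSet_iff _).2 ⟨hzero,
    fun r c hc => hs.exists_mul_eq_mul_of_mem_regularModulo hg r hc, fun r c hc hrc => ?_⟩
  obtain ⟨e, heb, he⟩ := hs.exists_mem_regularModulo_twoSidedAnnihilator hg b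
  refine ⟨e, he, hs.mem_twoSidedAnnihilator_iff_right.1 ((mem_regularModulo.1 hc).2 r ?_) e heb⟩
  rw [hrc]
  exact TwoSidedIdeal.zero_mem _

theorem le_regularModulo_of_ker_le (hs : IsSemiprimeRing R) {A : Type*} [Ring A] {φ : R →+* A}
    {S : Submonoid R} (hS : ∀ s ∈ S, IsUnit (φ s))
    (hker : TwoSidedIdeal.ker φ ≤ twoSidedAnnihilator b) :
    S ≤ regularModulo (twoSidedAnnihilator b) := by
  have hzero : ∀ y ∈ b, φ y = 0 → y = 0 := fun y hy hφy =>
    hs.eq_zero_of_mem_of_mem_twoSidedAnnihilator hy (hker ((TwoSidedIdeal.mem_ker φ).2 hφy))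
  refine fun t ht => mem_regularModulo.2 ⟨fun x hx => ?_, fun x hx => ?_⟩
  · refine mem_twoSidedAnnihilator.2 fun z hz => hzero _ (b.mul_mem_left x z hz) ?_
    rw [← (hS t ht).mul_right_eq_zero, ← map_mul, ← mul_assoc, mem_twoSidedAnnihilator.1 hx z hz,
      map_zero]
  · refine hs.mem_twoSidedAnnihilator_iff_right.2 fun z hz => hzero _ (b.mul_mem_right z x hz) ?_
    rw [← (hS t ht).mul_left_eq_zero, ← map_mul, mul_assoc,
      hs.mem_twoSidedAnnihilator_iff_right.1 hx z hz, map_zero]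

theorem exists_mem_minPrimes_le_regularModulo (hs : IsSemiprimeRing R) (hg : IsLeftGoldieRing R)
    {A : Type*} [Ring A] {φ : R →+* A} {S : Submonoid R} (hS : ∀ s ∈ S, IsUnit (φ s))
    (hφ : ∀ c ∈ nonZeroDivisors R, φ c ≠ 0) : ∃ p ∈ minPrimes R, S ≤ regularModulo p := by
  obtain ⟨p, hp, hker⟩ := hs.exists_mem_minPrimes_le hg (a := TwoSidedIdeal.ker φ)
    fun c hc h => hφ c hc ((TwoSidedIdeal.mem_ker φ).1 h)
  obtain ⟨b, rfl⟩ := hs.exists_eq_twoSidedAnnihilator_of_mem_minPrimes hg.acc_leftAnnihilators hp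
  exact ⟨_, hp, hs.le_regularModulo_of_ker_le hS hker⟩

theorem isAntichain_regularModulo (hs : IsSemiprimeRing R) (hg : IsLeftGoldieRing R) :
    IsAntichain (· ≤ ·) {S | ∃ p ∈ minPrimes R, S = regularModulo p} := by
  rintro _ ⟨p, hp, rfl⟩ _ ⟨q, hq, rfl⟩ hne hle
  obtain ⟨b, rfl⟩ := hs.exists_eq_twoSidedAnnihilator_of_mem_minPrimes hg.acc_leftAnnihilators hp
  obtain ⟨e, heb, he⟩ := hs.exists_mem_regularModulo_twoSidedAnnihilator hg b
  have hbq : ¬ b ≤ q := fun h => notMem_of_mem_regularModulo hq.prop.1 (hle he) (h heb)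
  have hpq : twoSidedAnnihilator b ≤ q :=
    (hq.prop.twoSidedAnnihilator_le_or_le b).resolve_right hbq
  exact hne (congrArg regularModulo (hq.eq_of_le hp.prop hpq))

end IsSemiprimeRing

end RegularModulo

namespace FreeExt

variable {K R A : Type*} [CommRing K] [Ring R] [Algebra K R] [Ring A] [Algebra K A] {X : Type*}

/-- The homomorphism `R⟨X⟩ → A` given by the universal property of `R⟨X⟩`: it extends `φ : R → A`
and sends the indeterminate with index `x` to `g x`. -/
noncomputable def lift (φ : R →ₐ[K] A) (g : X → A) : FreeExt K R X →ₐ[K] A :=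
  RingQuot.liftAlgHom K ⟨FreeAlgebra.lift K (Sum.elim φ g), by
    rintro _ _ (⟨a, b⟩ | ⟨a, b⟩ | k) <;> simp⟩

theorem lift_incl (φ : R →ₐ[K] A) (g : X → A) (r : R) : lift φ g (incl K R X r) = φ r :=
  (RingQuot.liftAlgHom_mkAlgHom_apply K _ _ _).trans (by simp)

theorem lift_var (φ : R →ₐ[K] A) (g : X → A) (x : X) : lift φ g (var K R x) = g x :=
  (RingQuot.liftAlgHom_mkAlgHom_apply K _ _ _).trans (by simp)

theorem algHom_ext {f g : FreeExt K R X →ₐ[K] A} (hincl : ∀ r, f (incl K R X r) = g (incl K R X r))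
    (hvar : ∀ x, f (var K R x) = g (var K R x)) : f = g := by
  refine RingQuot.ringQuot_ext' K f g (FreeAlgebra.hom_ext (funext ?_))
  rintro (r | x)
  · exact hincl r
  · exact hvar x

end FreeExt

namespace Inverted

variable {K R A : Type*} [CommRing K] [Ring R] [Algebra K R] [Ring A] [Algebra K A]
  {S : Submonoid R}

theorem of_mul_inv (s : S) : of K S s * inv K S s = 1 := by
  simpa [of, inv] using RingQuot.mkAlgHom_rel K (InvertRel.mul_inv (K := K) s)

theorem inv_mul_of (s : S) : inv K S s * of K S s = 1 := by
  simpa [of, inv] using RingQuot.mkAlgHom_rel K (InvertRel.inv_mul (K := K) s)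

theorem isUnit_of (s : S) : IsUnit (of K S s) :=
  ⟨⟨_, _, of_mul_inv s, inv_mul_of s⟩, rfl⟩

/-- The homomorphism `R⟨S⁻¹⟩ → A` given by the universal property of `R⟨S⁻¹⟩`: it extends a
homomorphism `φ : R → A` that inverts `S`. -/
noncomputable def lift (φ : R →ₐ[K] A) (hφ : ∀ s : S, IsUnit (φ s)) : Inverted K S →ₐ[K] A :=
  RingQuot.liftAlgHom K ⟨FreeExt.lift φ fun s => ↑(hφ s).unit⁻¹, by
    rintro _ _ (s | s) <;> simp [FreeExt.lift_incl, FreeExt.lift_var]⟩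

theorem lift_of (φ : R →ₐ[K] A) (hφ : ∀ s : S, IsUnit (φ s)) (r : R) :
    lift φ hφ (of K S r) = φ r :=
  (RingQuot.liftAlgHom_mkAlgHom_apply K _ _ _).trans (FreeExt.lift_incl _ _ r)

theorem algHom_ext {f g : Inverted K S →ₐ[K] A} (h : ∀ r, f (of K S r) = g (of K S r)) :
    f = g := by
  refine RingQuot.ringQuot_ext' K f g (FreeExt.algHom_ext h fun s => ?_)
  change f (inv K S s) = g (inv K S s)
  refine left_inv_eq_right_inv (a := f (of K S s)) ?_ ?_
  · rw [← map_mul, inv_mul_of, map_one]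
  · rw [h, ← map_mul, of_mul_inv, map_one]

end Inverted

theorem exists_mul_eq_zero_of_numeratorRingHom_eq_zero {R : Type*} [Ring R] {S : Submonoid R}
    [OreLocalization.OreSet S] {r : R} (h : OreLocalization.numeratorRingHom (S := S) r = 0) :
    ∃ s : S, (s : R) * r = 0 := by
  rw [← map_zero (OreLocalization.numeratorRingHom (S := S))] at h
  obtain ⟨u, v, huv, huv_one⟩ := OreLocalization.oreDiv_eq_iff.1 h
  have hu : (u : R) = v := by simpa using huv_one
  exact ⟨u, by rw [hu]; simpa using huv.symm⟩

theorem IsLeftDenominatorSet.exists_mem_minPrimes_le_regularModulo {R : Type*} [Ring R]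
    {S : Submonoid R} (hS : IsLeftDenominatorSet S) (hs : IsSemiprimeRing R)
    (hg : IsLeftGoldieRing R) : ∃ p ∈ minPrimes R, S ≤ regularModulo p := by
  obtain ⟨hzero, ⟨_⟩⟩ := hS
  refine hs.exists_mem_minPrimes_le_regularModulo hg
    (φ := OreLocalization.numeratorRingHom (S := S))
    (fun t ht => OreLocalization.numerator_isUnit ⟨t, ht⟩) fun c hc hφc => hzero ?_
  obtain ⟨t, ht⟩ := exists_mul_eq_zero_of_numeratorRingHom_eq_zero hφc
  rw [← hc.2 _ ht]
  exact t.2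

section Localization

variable {K R : Type*} [CommRing K] [Ring R] [Algebra K R] {S : Submonoid R}

namespace Inverted

variable (K S) in
/-- The canonical homomorphism from `R⟨S⁻¹⟩` to the Ore localization `S⁻¹R`; it is used to transport
nontriviality and left fractions. -/
noncomputable def toOreLocalization [OreLocalization.OreSet S] :
    Inverted K S →ₐ[K] OreLocalization S R :=
  lift { OreLocalization.numeratorRingHom (S := S) with commutes' := fun _ => rfl }
    OreLocalization.numerator_isUnit

variable (K S) in
/-- The canonical homomorphism `S⁻¹R → R⟨S⁻¹⟩`, sending `s⁻¹r` to the fraction of the same name. -/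
noncomputable def ofOreLocalization [OreLocalization.OreSet S] :
    OreLocalization S R →ₐ[K] Inverted K S :=
  { OreLocalization.universalHom (of K S : R →+* Inverted K S)
      (IsUnit.liftRight ((of K S : R →* Inverted K S).comp S.subtype) isUnit_of)
      (fun _ => rfl) with
    commutes' := fun k =>
      (OreLocalization.universalHom_commutes _ _ _).trans ((of K S).commutes k) }

theorem ofOreLocalization_oreDiv [OreLocalization.OreSet S] (r : R) (s : S) :
    ofOreLocalization K S (r /ₒ s) = inv K S s * of K S r :=
  congrArg (· * of K S r) (Units.inv_eq_of_mul_eq_one_right (of_mul_inv s))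

theorem ofOreLocalization_toOreLocalization [OreLocalization.OreSet S] (z : Inverted K S) :
    ofOreLocalization K S (toOreLocalization K S z) = z := by
  have hid : (ofOreLocalization K S).comp (toOreLocalization K S) = AlgHom.id K (Inverted K S) := by
    refine algHom_ext (A := Inverted K S) fun r => ?_
    exact (congrArg _ (lift_of _ _ r)).trans
      (OreLocalization.universalHom_commutes _ _ fun _ => rfl)
  exact DFunLike.congr_fun hid z

end Inverted

theorem IsLeftDenominatorSet.isLeftLocalizableSet (hS : IsLeftDenominatorSet S) :
    IsLeftLocalizableSet K S := by
  obtain ⟨hzero, ⟨_⟩⟩ := hS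
  have : Nontrivial (OreLocalization S R) := OreLocalization.nontrivial_iff.2 hzero
  refine ⟨hzero, (Inverted.toOreLocalization K S).toRingHom.domain_nontrivial, fun z => ?_⟩
  obtain ⟨r, s, hrs⟩ : ∃ (r : R) (s : S), Inverted.toOreLocalization K S z = r /ₒ s := by
    induction Inverted.toOreLocalization K S z with | _ r s
    exact ⟨r, s, rfl⟩
  exact ⟨s, r, by
    rw [← Inverted.ofOreLocalization_oreDiv, ← hrs, Inverted.ofOreLocalization_toOreLocalization]⟩

theorem IsLeftLocalizableSet.exists_mem_minPrimes_le_regularModulo (hS : IsLeftLocalizableSet K S)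
    (hle : nonZeroDivisors R ≤ S) (hs : IsSemiprimeRing R) (hg : IsLeftGoldieRing R) :
    ∃ p ∈ minPrimes R, S ≤ regularModulo p := by
  have := hS.nontrivial
  have hunit : ∀ s ∈ S, IsUnit (Inverted.of K S s) := fun s hsS => Inverted.isUnit_of ⟨s, hsS⟩
  exact hs.exists_mem_minPrimes_le_regularModulo hg (A := Inverted K S) (φ := Inverted.of K S) hunit
    fun c hc => (hunit c (hle hc)).ne_zero

end Localization

theorem mainTheorem2 {K : Type v} {R : Type u} [CommRing K] [Ring R] [Algebra K R]
    (hsemiprime : IsSemiprimeRing R) (hgoldie : IsLeftGoldieRing R) :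
    {S : Submonoid R | Maximal (IsLeftLocalizableSet K) S ∧ nonZeroDivisors R ≤ S} =
        {S : Submonoid R | Maximal IsLeftDenominatorSet S} ∧
      {S : Submonoid R | Maximal IsLeftDenominatorSet S} =
        {S : Submonoid R | ∃ p ∈ minPrimes R, S = regularModulo p} := by
  have hanti := hsemiprime.isAntichain_regularModulo hgoldie
  have hregular : ∀ S, (∃ p ∈ minPrimes R, S = regularModulo p) →
      IsLeftDenominatorSet S ∧ nonZeroDivisors R ≤ S := by
    rintro _ ⟨p, hp, rfl⟩
    obtain ⟨b, rfl⟩ :=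
      hsemiprime.exists_eq_twoSidedAnnihilator_of_mem_minPrimes hgoldie.acc_leftAnnihilators hp
    exact ⟨hsemiprime.isLeftDenominatorSet_regularModulo_twoSidedAnnihilator hgoldie
        (mt twoSidedAnnihilator_eq_top_iff.2 hp.prop.1),
      hsemiprime.nonZeroDivisors_le_regularModulo_twoSidedAnnihilator b⟩
  have hden : {S : Submonoid R | Maximal IsLeftDenominatorSet S} =
      {S : Submonoid R | ∃ p ∈ minPrimes R, S = regularModulo p} :=
    setOf_maximal_eq_of_isAntichain hanti (fun S hS => (hregular S hS).1) fun S hS => by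
      obtain ⟨p, hp, hle⟩ := hS.exists_mem_minPrimes_le_regularModulo hsemiprime hgoldie
      exact ⟨_, ⟨p, hp, rfl⟩, hle⟩
  refine ⟨?_, hden⟩
  rw [hden]
  simp only [maximal_and_le_iff]
  refine setOf_maximal_eq_of_isAntichain hanti
    (fun S hS => ⟨(hregular S hS).1.isLeftLocalizableSet, (hregular S hS).2⟩) fun S hS => ?_
  obtain ⟨p, hp, hle⟩ := hS.1.exists_mem_minPrimes_le_regularModulo hS.2 hsemiprime hgoldie
  exact ⟨_, ⟨p, hp, rfl⟩, hle⟩
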